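/- Let $G$ be a finite group with irreducible complex representations $(V_1,\rho_1),\dots,(V_k,\rho_k)$ (one from each isomorphism class), each $V_j$ carrying a $G$-invariant Hermitian inner product and an orthonormal basis $B_j$. Let $X$ be a homogeneous space for $G$, that is, a finite non-empty set with a transitive action of $G$. Let $\mathbb{C}X$ be the permutation representation, with basis $\{e_x : x\in X\}$ and action $e_g\cdot e_x=e_{gx}$ of the group algebra $\mathbb{C}G$, and let $m(V_j,\mathbb{C}X)$ be the multiplicity of $V_j$ in $\mathbb{C}X$, so that $\mathbb{C}X\cong\bigoplus_{j=1}^k V_j^{m(V_j,\mathbb{C}X)}$. For $h=\sum_{x} h(x)e_x\in\mathbb{C}X$ put $\|h\|_{\rm TV}=\frac12\sum_{x\in X}|h(x)|$ and $\|h\|_2=\big(\sum_{x\in X}|h(x)|^2\big)^{1/2}$; let $\overline{u}=\frac{1}{|X|}\sum_{x\in X}e_x$. Let $Q$ be a probability distribution on $G$, let $q=\sum_{g\in G}Q(g)e_g\in\mathbb{C}G$, let $\hat Q(\rho_j)=\sum_{g\in G}Q(g)[\rho_j(g)]_{B_j}$ be its Fourier transform, and write $\|A\|_{\rm Fb}^2={\rm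 Tr}(AA^*)$. Then $$\frac{1}{4|X|}\sum_{V_j\neq{\rm triv}}m(V_j,\mathbb{C}X)\,\|\hat Q(\rho_j)\|_{\rm Fb}^2\ \le\ \frac{1}{|X|}\sum_{x\in X}\|q\cdot e_x-\overline{u}\|_{\rm TV}^2\ \le\ \frac14\sum_{V_j\neq{\rm triv}}m(V_j,\mathbb{C}X)\,\|\hat Q(\rho_j)\|_{\rm Fb}^2 ,$$ where the sums run over the $j$ for which $V_j$ is not isomorphic to the trivial representation. If furthermore $\|q\cdot e_x\|_2$ does not depend on $x\in X$, then for every $x\in X$ $$\frac{1}{4|X|}\sum_{V_j\neq{\rm triv}}m(V_j,\mathbb{C}X)\,\|\hat Q(\rho_j)\|_{\rm Fb}^2\ \le\ \|q\cdot e_x-\overline{u}\|_{\rm TV}^2\ \le\ \frac14\sum_{V_j\neq{\rm triv}}m(V_j,\mathbb{C}X)\,\|\hat Q(\rho_j)\|_{\rm Fb}^2 .$$ -/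

import Mathlib

open scoped MonoidAlgebra Matrix

noncomputable section

namespace HomogeneousWalk

universe u v w

section Irreducibles

variable {G : Type u} [Group G] {ι : Type v} {V : ι → Type w}
  [∀ i, AddCommGroup (V i)] [∀ i, Module ℂ (V i)]

/-- The family `ρ i` lists every irreducible complex representation of `G` exactly once, up to
isomorphism. (A finite-dimensional representation can be written on some `ℂⁿ` by a choice of
basis, so it is enough to ask that every irreducible representation on some `ℂⁿ` is listed.) -/
structure IsCompleteListOfIrreducibles (ρ : ∀ i, Representation ℂ G (V i)) : Prop where
  finiteDimensional : ∀ i, FiniteDimensional ℂ (V i)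
  irreducible : ∀ i, (ρ i).IsIrreducible
  pairwise_not_equiv : ∀ i j, i ≠ j → IsEmpty ((ρ i).Equiv (ρ j))
  exhaustive : ∀ (n : ℕ) (σ : Representation ℂ G (Fin n → ℂ)), σ.IsIrreducible →
    ∃ i, Nonempty (σ.Equiv (ρ i))

/-- `Λ ≅ ⨁ j, (V j) ^ (m j)` as representations: the direct sum runs over all pairs `(j, l)`
with `l < m j`. -/
def IsMultiplicityFamily (ρ : ∀ i, Representation ℂ G (V i))
    {W : Type*} [AddCommGroup W] [Module ℂ W] (Λ : Representation ℂ G W) (m : ι → ℕ) : Prop :=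
  Nonempty (Λ.Equiv (Representation.directSum fun p : Σ j, Fin (m j) => ρ p.1))

lemma nonempty_asModule_equiv {A B : Type*} [AddCommGroup A] [Module ℂ A] [AddCommGroup B]
    [Module ℂ B] {α : Representation ℂ G A} {β : Representation ℂ G B} (φ : α.Equiv β) :
    Nonempty (α.asModule ≃ₗ[ℂ[G]] β.asModule) :=
  ⟨LinearEquiv.ofBijective
    (Representation.IntertwiningMap.equivLinearMapAsModule _ _ φ.toIntertwiningMap)
    φ.toLinearEquiv.bijective⟩

/-- Every simple submodule of a finite-dimensional representation is one of the listed ones. -/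
lemma IsCompleteListOfIrreducibles.exists_equiv_of_isSimpleModule
    {ρ : ∀ i, Representation ℂ G (V i)} (h : IsCompleteListOfIrreducibles ρ)
    {W : Type*} [AddCommGroup W] [Module ℂ W] [FiniteDimensional ℂ W]
    (Λ : Representation ℂ G W) (S : Submodule ℂ[G] Λ.asModule) (hS : IsSimpleModule ℂ[G] S) :
    ∃ i, Nonempty (S ≃ₗ[ℂ[G]] (ρ i).asModule) := by
  let T := Subrepresentation.ofSubmodule' S
  let τ := T.toRepresentation
  let b := Module.finBasis ℂ T.toSubmodule
  let n := Module.finrank ℂ T.toSubmodule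
  let e : T.toSubmodule ≃ₗ[ℂ] (Fin n → ℂ) := b.equivFun
  let σ : Representation ℂ G (Fin n → ℂ) :=
    { toFun := fun g => e.conj (τ g)
      map_one' := by ext; simp
      map_mul' := fun g k => by rw [map_mul]; exact LinearEquiv.conj_comp e _ _ }
  let φ : τ.Equiv σ := Representation.Equiv.mk e (fun g => by ext x; simp [σ])
  obtain ⟨ψ⟩ := nonempty_asModule_equiv φ
  let j : τ.IntertwiningMap Λ :=
    { toLinearMap := T.toSubmodule.subtype
      isIntertwining' := fun g => by ext x; rfl }
  let J := Representation.IntertwiningMap.equivLinearMapAsModule _ _ j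
  have hJ : Function.Injective J := Subtype.val_injective
  have hJS : LinearMap.range J = S := by
    ext x
    constructor
    · rintro ⟨y, rfl⟩
      exact y.2
    · intro hx
      exact ⟨⟨x, hx⟩, rfl⟩
  let θ : S ≃ₗ[ℂ[G]] τ.asModule :=
    ((LinearEquiv.ofInjective J hJ).trans (LinearEquiv.ofEq _ _ hJS)).symm
  have hσ : IsSimpleModule ℂ[G] σ.asModule := IsSimpleModule.congr (θ.trans ψ).symm
  obtain ⟨i, ⟨χ⟩⟩ := h.exhaustive n σ ((Representation.irreducible_iff_isSimpleModule_asModule σ).2 hσ)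
  obtain ⟨ψ'⟩ := nonempty_asModule_equiv χ
  exact ⟨i, ⟨(θ.trans ψ).trans ψ'⟩⟩

/-- Multiplicities exist. -/
lemma IsCompleteListOfIrreducibles.exists_isMultiplicityFamily [Finite G]
    {ρ : ∀ i, Representation ℂ G (V i)} (h : IsCompleteListOfIrreducibles ρ)
    {W : Type*} [AddCommGroup W] [Module ℂ W] [FiniteDimensional ℂ W]
    (Λ : Representation ℂ G W) : ∃ m : ι → ℕ, IsMultiplicityFamily ρ Λ m := by
  classical
  have : IsSemisimpleModule ℂ[G] Λ.asModule := by
    have : NeZero (Nat.card G : ℂ) := ⟨by exact_mod_cast Nat.card_pos.ne'⟩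
    infer_instance
  have : Module.Finite ℂ[G] Λ.asModule := Module.Finite.of_restrictScalars_finite ℂ _ _
  obtain ⟨n, S, e, hS⟩ :=
    IsSemisimpleModule.exists_linearEquiv_fin_dfinsupp ℂ[G] Λ.asModule
  choose f hf using fun i => h.exists_equiv_of_isSimpleModule Λ (S i) (hS i)
  let m : ι → ℕ := fun j => Fintype.card {i : Fin n // f i = j}
  let r : Fin n ≃ Σ j, Fin (m j) :=
    (Equiv.sigmaFiberEquiv f).symm.trans
      (Equiv.sigmaCongrRight fun j => Fintype.equivFin {i : Fin n // f i = j})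
  have hr : ∀ p, f (r.symm p) = p.1 := by
    intro p
    exact ((Fintype.equivFin {i : Fin n // f i = p.1}).symm p.2).2
  have hψ : ∀ p : Σ j, Fin (m j), Nonempty (S (r.symm p) ≃ₗ[ℂ[G]] (ρ p.1).asModule) := by
    intro p
    have := hf (r.symm p)
    rwa [hr] at this
  let ψ := fun p => (hψ p).some
  let E : Λ.asModule ≃ₗ[ℂ[G]] (Π₀ p : Σ j, Fin (m j), (ρ p.1).asModule) :=
    (e.trans (DirectSum.lequivCongrLeft ℂ[G] r)).trans (DFinsupp.mapRange.linearEquiv ψ)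
  refine ⟨m, ⟨Representation.Equiv.mk ?_ ?_⟩⟩
  · exact
    (Λ.asModuleEquiv.symm.trans (E.restrictScalars ℂ)).trans
      (DFinsupp.mapRange.linearEquiv fun p => (ρ p.1).asModuleEquiv)
  · intro g
    refine LinearMap.ext fun x => ?_
    refine DFinsupp.ext fun p => ?_
    have h1 := congrArg (fun z => z p)
      (E.map_smul (MonoidAlgebra.of ℂ G g) (Λ.asModuleEquiv.symm x))
    have h2 := (ρ p.1).asModuleEquiv_map_smul (MonoidAlgebra.of ℂ G g)
      (E (Λ.asModuleEquiv.symm x) p)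
    rw [Representation.asAlgebraHom_of] at h2
    rw [← Representation.asModuleEquiv_symm_map_rho] at h1
    exact (congrArg (ρ p.1).asModuleEquiv h1).trans h2

/-- A decomposition into irreducibles expresses the character by the multiplicities. -/
lemma IsMultiplicityFamily.character_eq [Fintype ι] [∀ i, FiniteDimensional ℂ (V i)]
    {ρ : ∀ i, Representation ℂ G (V i)} {W : Type*} [AddCommGroup W] [Module ℂ W]
    [FiniteDimensional ℂ W] {Λ : Representation ℂ G W} {m : ι → ℕ}
    (hm : IsMultiplicityFamily ρ Λ m) (g : G) :
    Λ.character g = ∑ j, (m j : ℂ) * (ρ j).character g := by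
  classical
  obtain ⟨φ⟩ := hm
  have : Module.Finite ℂ (DirectSum (Σ j, Fin (m j)) fun p => V p.1) :=
    Module.Finite.equiv φ.toLinearEquiv
  rw [Representation.char_iso φ]
  have h1 : (Representation.directSum fun p : Σ j, Fin (m j) => ρ p.1) g =
      ∑ p : Σ j, Fin (m j), (DirectSum.lof ℂ (Σ j, Fin (m j)) (fun p => V p.1) p).comp
        ((ρ p.1 g).comp (DirectSum.component ℂ (Σ j, Fin (m j)) (fun p => V p.1) p)) := by
    refine DirectSum.linearMap_ext ℂ fun q => LinearMap.ext fun x => ?_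
    rw [LinearMap.comp_apply, LinearMap.comp_apply, LinearMap.sum_apply,
      Finset.sum_eq_single q]
    · simp [DirectSum.component.lof_self]
    · intro p _ hp
      rw [LinearMap.comp_apply, LinearMap.comp_apply, DirectSum.component.of, dif_neg hp.symm,
        map_zero, map_zero]
    · simp
  rw [Representation.character, h1, map_sum, Fintype.sum_sigma]
  refine Finset.sum_congr rfl fun j _ => ?_
  have h2 : ∀ l : Fin (m j), LinearMap.trace ℂ _
      ((DirectSum.lof ℂ (Σ j, Fin (m j)) (fun p => V p.1) ⟨j, l⟩).comp
        ((ρ j g).comp (DirectSum.component ℂ (Σ j, Fin (m j)) (fun p => V p.1) ⟨j, l⟩))) =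
      (ρ j).character g := by
    intro l
    rw [LinearMap.trace_comp_comm']
    congr 1
    ext x
    simp [DirectSum.component.lof_self]
  simp [h2]

/-- Multiplicities are unique. -/
lemma IsCompleteListOfIrreducibles.multiplicityFamily_unique [Finite G] [Fintype ι]
    {ρ : ∀ i, Representation ℂ G (V i)} (h : IsCompleteListOfIrreducibles ρ)
    {W : Type*} [AddCommGroup W] [Module ℂ W] [FiniteDimensional ℂ W]
    {Λ : Representation ℂ G W} {m m' : ι → ℕ} (hm : IsMultiplicityFamily ρ Λ m)
    (hm' : IsMultiplicityFamily ρ Λ m') : m = m' := by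
  classical
  have := h.finiteDimensional
  have := Fintype.ofFinite G
  have hG : (Nat.card G : ℂ) ≠ 0 := by exact_mod_cast Nat.card_pos.ne'
  have : Invertible (Nat.card G : ℂ) := invertibleOfNonzero hG
  have key : ∀ (k : ι → ℕ), IsMultiplicityFamily ρ Λ k → ∀ i,
      (Nat.card G : ℂ)⁻¹ * ∑ g : G, Λ.character g * (ρ i).character g⁻¹ = k i := by
    intro k hk i
    have hs : ∀ j, (Nat.card G : ℂ)⁻¹ * ∑ g : G, (ρ j).character g * (ρ i).character g⁻¹ =
        if j = i then 1 else 0 := by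
      intro j
      have := h.irreducible j
      have := h.irreducible i
      rw [Representation.char_orthonormal]
      by_cases hji : j = i
      · subst hji
        simp [show Nonempty ((ρ j).Equiv (ρ j)) from ⟨.refl _⟩]
      · have := h.pairwise_not_equiv i j (Ne.symm hji)
        simp only [hji, if_false, ite_eq_right_iff]
        exact fun hne => (not_isEmpty_iff.2 hne this).elim
    calc _ = ∑ j, (k j : ℂ) *
          ((Nat.card G : ℂ)⁻¹ * ∑ g : G, (ρ j).character g * (ρ i).character g⁻¹) := by
          simp_rw [hk.character_eq, Finset.sum_mul, Finset.mul_sum]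
          rw [Finset.sum_comm]
          refine Finset.sum_congr rfl fun j _ => Finset.sum_congr rfl fun g _ => by ring
      _ = k i := by simp only [hs]; simp
  funext i
  have := (key m hm i).symm.trans (key m' hm' i)
  exact_mod_cast this

/-- The multiplicity `m(V j, Λ)` of the irreducible representation `ρ j` in `Λ`: the exponents
in the decomposition `Λ ≅ ⨁ j, (V j) ^ (m j)`, which exist and are uniquely determined. -/
def multiplicity [Finite G] {ρ : ∀ i, Representation ℂ G (V i)}
    (h : IsCompleteListOfIrreducibles ρ)
    {W : Type*} [AddCommGroup W] [Module ℂ W] [FiniteDimensional ℂ W]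
    (Λ : Representation ℂ G W) : ι → ℕ :=
  (h.exists_isMultiplicityFamily Λ).choose

lemma multiplicity_spec [Finite G] {ρ : ∀ i, Representation ℂ G (V i)}
    (h : IsCompleteListOfIrreducibles ρ)
    {W : Type*} [AddCommGroup W] [Module ℂ W] [FiniteDimensional ℂ W]
    (Λ : Representation ℂ G W) : IsMultiplicityFamily ρ Λ (multiplicity h Λ) :=
  (h.exists_isMultiplicityFamily Λ).choose_spec

end Irreducibles

section Fourier

variable {G : Type u} [Fintype G] [Group G] {V : Type w} {β : Type*} [Fintype β] [DecidableEq β]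

/-- The Fourier transform of `f : G → ℂ` at the representation `ρ`, as a matrix in the orthonormal
basis `B`: `∑ g, f g • [ρ g]_B`. -/
def fourierMatrix [NormedAddCommGroup V] [InnerProductSpace ℂ V] (ρ : Representation ℂ G V)
    (B : OrthonormalBasis β ℂ V) (f : G → ℂ) : Matrix β β ℂ :=
  ∑ g, f g • LinearMap.toMatrix B.toBasis B.toBasis (ρ g)

/-- The squared Frobenius norm `Tr (A A*)`, a real number. -/
def frobeniusSq (A : Matrix β β ℂ) : ℝ := ((A * Aᴴ).trace).re

end Fourier

section Walk

/-- The element `q = ∑ g, Q g • e_g` of the group algebra. -/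
def groupAlgebraElement {G : Type u} [Fintype G] (Q : G → ℝ) : ℂ[G] :=
  ∑ g, MonoidAlgebra.single g (Q g : ℂ)

/-- The action `q · t` of the group algebra `ℂ G` on the permutation module `ℂ X`. Here Mathlib's
notation `ℂ[X]` stands for the vector space with basis `e_x = single x 1`. -/
def act {G : Type u} [Group G] {X : Type v} [MulAction G X] (q : ℂ[G]) (t : ℂ[X]) : ℂ[X] :=
  (Representation.ofMulAction ℂ G X).asAlgebraHom q t

/-- The uniform distribution `(1/|X|) ∑ x, e_x` as an element of `ℂ X`. -/
def uniform (X : Type v) [Fintype X] : ℂ[X] :=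
  ∑ x, MonoidAlgebra.single x ((1 : ℂ) / (Fintype.card X : ℂ))

/-- The total variation norm `(1/2) ∑ y, |h y|` on `ℂ X`. -/
def tvNorm {X : Type v} [Fintype X] (h : ℂ[X]) : ℝ := (1 / 2) * ∑ y, ‖h.coeff y‖

/-- The norm on `ℂ X` for which the basis `e_x` is orthonormal. -/
def l2Norm {X : Type v} [Fintype X] (h : ℂ[X]) : ℝ := √(∑ y, ‖h.coeff y‖ ^ 2)

/-- The element `q · e_x` of `ℂ X`, i.e. the distribution of `g • x` for `g` distributed
according to `Q`. -/
def step {G : Type u} [Fintype G] [Group G] {X : Type v} [MulAction G X] (Q : G → ℝ) (x : X) :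
    ℂ[X] :=
  act (groupAlgebraElement Q) (MonoidAlgebra.single x 1)

open scoped Classical in
/-- The sum of `m(V j, ℂ X) * ‖Q̂(ρ j)‖²` (Frobenius norm) over all `j` for which `V j` is not
isomorphic to the trivial representation. -/
def nontrivialFourierSum {G : Type u} [Fintype G] [Group G] (X : Type v) [MulAction G X]
    [Finite X] {ι : Type*} [Fintype ι] {V : ι → Type*} [∀ j, NormedAddCommGroup (V j)]
    [∀ j, InnerProductSpace ℂ (V j)] {ρ : ∀ j, Representation ℂ G (V j)}
    (hρ : IsCompleteListOfIrreducibles ρ) {β : ι → Type*} [∀ j, Fintype (β j)]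
    [∀ j, DecidableEq (β j)] (B : ∀ j, OrthonormalBasis (β j) ℂ (V j)) (Q : G → ℝ) : ℝ :=
  ∑ j with ¬ Nonempty ((ρ j).Equiv (Representation.trivial ℂ G ℂ)),
    (multiplicity hρ (Representation.ofMulAction ℂ G X) j : ℝ) *
      frobeniusSq (fourierMatrix (ρ j) (B j) fun g => (Q g : ℂ))

end Walk

end HomogeneousWalk

namespace HomogeneousWalk

open Finset

/-! ### Character sums and the multiplicity of the trivial representation. -/

section Representations

variable {G : Type*} [Group G]

/-! Everything rests on the exact identity `∑ x, ‖q·e_x - u‖₂² = ∑ m_j ‖Q̂(ρ_j)‖²`, summed over the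
nontrivial `j` on the right (`sum_l2Norm_step_sub_uniform_sq`). It is combined with `‖h‖₂² ≤ 4
‖h‖_TV² ≤ |X| ‖h‖₂²`, whose two halves give the lower and the upper bound.

Both sides of the identity equal `∑ g h, Q g Q h Fix(g h⁻¹) - 1`, where `Fix` counts fixed points in
`X`. On the Fourier side (`nontrivialFourierSum_eq`), unitarity turns `‖Q̂(ρ_j)‖²` into the same
quadratic form with the character `χ_j` in place of `Fix`, and `∑ m_j χ_j` is the permutation
character `Fix`; the `1` removed is the contribution of the trivial representation, which occurs
once because the action is transitive. On the walk side (`sum_l2Norm_step_sq`), expanding the square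
counts the `x` with `g • x = h • x`; the `1` removed is `1/|X|` for each point `x`.

If `‖q·e_x‖₂` is constant in `x`, every point carries the same share of the identity, so the
averaged bounds become pointwise ones. -/

lemma isIrreducible_of_finrank_eq_one {V : Type*} [AddCommGroup V] [Module ℂ V]
    (ρ : Representation ℂ G V) (h : Module.finrank ℂ V = 1) : ρ.IsIrreducible := by
  have : IsSimpleOrder (Submodule ℂ V) := is_simple_module_of_finrank_eq_one h
  exact
    { exists_pair_ne :=
        ⟨⊥, ⊤, fun he => bot_ne_top (congrArg Subrepresentation.toSubmodule he)⟩
      eq_bot_or_eq_top := fun S =>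
        (eq_bot_or_eq_top S.toSubmodule).imp
          (fun hS => Subrepresentation.toSubmodule_injective hS)
          (fun hS => Subrepresentation.toSubmodule_injective hS) }

lemma character_trivial (g : G) : (Representation.trivial ℂ G ℂ).character g = 1 := by
  have h : Representation.trivial ℂ G ℂ g = 1 := rfl
  rw [Representation.character, h, LinearMap.trace_one, Module.finrank_self, Nat.cast_one]

/-- The character of a permutation representation counts fixed points. -/
lemma character_ofMulAction {X : Type*} [MulAction G X] [Fintype X] [DecidableEq X] (g : G) :
    (Representation.ofMulAction ℂ G X).character g = #{x : X | g • x = x} := by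
  rw [Representation.character, LinearMap.trace_eq_matrix_trace ℂ (MonoidAlgebra.basis X ℂ),
    Matrix.trace, Finset.card_filter, Nat.cast_sum]
  refine Finset.sum_congr rfl fun x _ => ?_
  rw [Matrix.diag_apply, LinearMap.toMatrix_apply, MonoidAlgebra.basis_apply,
    Representation.ofMulAction_single]
  change (MonoidAlgebra.single (g • x) (1 : ℂ)).coeff x = _
  rw [MonoidAlgebra.coeff_single, Finsupp.single_apply]
  push_cast
  rfl

/-- Burnside's lemma with a single orbit. -/
lemma sum_character_ofMulAction [Fintype G] {X : Type*} [MulAction G X]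
    [MulAction.IsPretransitive G X] [Fintype X] [Nonempty X] :
    ∑ g : G, (Representation.ofMulAction ℂ G X).character g = Fintype.card G := by
  classical
  have := Fintype.ofFinite (Quotient (MulAction.orbitRel G X))
  have h := MulAction.sum_card_fixedBy_eq_card_orbits_mul_card_group G X
  have h1 : Fintype.card (Quotient (MulAction.orbitRel G X)) = 1 := by
    have := (MulAction.pretransitive_iff_subsingleton_quotient G X).1 inferInstance
    have hne : Nonempty (Quotient (MulAction.orbitRel G X)) := ‹Nonempty X›.map (Quotient.mk _)
    exact Fintype.card_eq_one_iff_nonempty_unique.2 (nonempty_unique _)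
  rw [h1, one_mul] at h
  rw [← h, Nat.cast_sum]
  refine Finset.sum_congr rfl fun g _ => ?_
  rw [character_ofMulAction, ← Fintype.card_subtype]
  rfl

-- Orthogonality against the trivial character, which is identically `1`.
open scoped Classical in
lemma sum_character_of_isIrreducible [Fintype G] {V : Type*} [AddCommGroup V] [Module ℂ V]
    [FiniteDimensional ℂ V] (ρ : Representation ℂ G V) (hρ : ρ.IsIrreducible) :
    ∑ g, ρ.character g =
      if Nonempty (ρ.Equiv (Representation.trivial ℂ G ℂ)) then (Fintype.card G : ℂ) else 0 := by
  have hG : (Nat.card G : ℂ) ≠ 0 := by exact_mod_cast Nat.card_pos.ne'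
  have : Invertible (Nat.card G : ℂ) := invertibleOfNonzero hG
  have := isIrreducible_of_finrank_eq_one (Representation.trivial ℂ G ℂ)
    (Module.finrank_self ℂ)
  have h := Representation.char_orthonormal ρ (Representation.trivial ℂ G ℂ)
  simp only [character_trivial, mul_one] at h
  rw [inv_mul_eq_iff_eq_mul₀ hG] at h
  have hiff : Nonempty ((Representation.trivial ℂ G ℂ).Equiv ρ) ↔
      Nonempty (ρ.Equiv (Representation.trivial ℂ G ℂ)) :=
    ⟨fun ⟨φ⟩ => ⟨φ.symm⟩, fun ⟨φ⟩ => ⟨φ.symm⟩⟩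
  rw [h, Nat.card_eq_fintype_card]
  simp only [hiff, mul_ite, mul_one, mul_zero]

open scoped Classical in
/-- The trivial representation has multiplicity one in a transitive permutation representation. -/
lemma sum_multiplicity_trivial [Fintype G] {X : Type*} [MulAction G X]
    [MulAction.IsPretransitive G X] [Fintype X] [Nonempty X] {ι : Type*} [Fintype ι]
    {V : ι → Type*} [∀ j, AddCommGroup (V j)] [∀ j, Module ℂ (V j)]
    {ρ : ∀ j, Representation ℂ G (V j)} (hρ : IsCompleteListOfIrreducibles ρ) {m : ι → ℕ}
    (hm : IsMultiplicityFamily ρ (Representation.ofMulAction ℂ G X) m) :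
    ∑ j with Nonempty ((ρ j).Equiv (Representation.trivial ℂ G ℂ)), m j = 1 := by
  have := hρ.finiteDimensional
  have h := sum_character_ofMulAction (G := G) (X := X)
  simp_rw [hm.character_eq] at h
  rw [Finset.sum_comm] at h
  simp_rw [← Finset.mul_sum, sum_character_of_isIrreducible _ (hρ.irreducible _), mul_ite,
    mul_zero] at h
  rw [← Finset.sum_filter, ← Finset.sum_mul] at h
  have hG : (Fintype.card G : ℂ) ≠ 0 := by exact_mod_cast Fintype.card_ne_zero
  have := (mul_eq_right₀ hG).1 h
  exact_mod_cast this

end Representations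

/-! ### Frobenius norms of Fourier transforms as quadratic forms in `Q`. -/

section Fourier

variable {G : Type*} [Group G] {V : Type*} [NormedAddCommGroup V] [InnerProductSpace ℂ V]
  {β : Type*} [Fintype β] [DecidableEq β]

/-- In an orthonormal basis, an invariant inner product makes `(ρ g)ᴴ` the matrix of `ρ g⁻¹`. -/
lemma conjTranspose_toMatrix (ρ : Representation ℂ G V)
    (hinv : ∀ (g : G) (v w : V), inner ℂ (ρ g v) (ρ g w) = inner ℂ v w)
    (B : OrthonormalBasis β ℂ V) (g : G) :
    (LinearMap.toMatrix B.toBasis B.toBasis (ρ g))ᴴ =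
      LinearMap.toMatrix B.toBasis B.toBasis (ρ g⁻¹) := by
  ext i j
  simp only [Matrix.conjTranspose_apply, LinearMap.toMatrix_apply, OrthonormalBasis.coe_toBasis,
    OrthonormalBasis.coe_toBasis_repr_apply, OrthonormalBasis.repr_apply_apply]
  -- With `ρ g⁻¹ (B j)` as second vector, invariance moves `g` across the inner product.
  have h := hinv g (B i) (ρ g⁻¹ (B j))
  rw [Representation.self_inv_apply] at h
  rw [← h]
  exact inner_conj_symm _ _

/-- Expand `Tr (A Aᴴ)` bilinearly: by unitarity `ρ g (ρ h)ᴴ = ρ (g h⁻¹)`, and the coefficients are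
real, so conjugation leaves them unchanged. -/
lemma frobeniusSq_fourierMatrix [Fintype G] (ρ : Representation ℂ G V)
    (hinv : ∀ (g : G) (v w : V), inner ℂ (ρ g v) (ρ g w) = inner ℂ v w)
    (B : OrthonormalBasis β ℂ V) (Q : G → ℝ) :
    frobeniusSq (fourierMatrix ρ B fun g => (Q g : ℂ)) =
      ∑ g, ∑ h, Q g * Q h * (ρ.character (g * h⁻¹)).re := by
  have h1 : ∀ g h, ((LinearMap.toMatrix B.toBasis B.toBasis (ρ g)) *
      (LinearMap.toMatrix B.toBasis B.toBasis (ρ h))ᴴ).trace = ρ.character (g * h⁻¹) := by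
    intro g h
    rw [conjTranspose_toMatrix ρ hinv B, ← LinearMap.toMatrix_mul, ← map_mul,
      ← LinearMap.trace_eq_matrix_trace, Representation.character]
  rw [frobeniusSq, fourierMatrix, Matrix.conjTranspose_sum, Finset.sum_mul_sum, Matrix.trace_sum,
    Complex.re_sum]
  refine Finset.sum_congr rfl fun g _ => ?_
  rw [Matrix.trace_sum, Complex.re_sum]
  refine Finset.sum_congr rfl fun h _ => ?_
  rw [Matrix.conjTranspose_smul, smul_mul_smul_comm, Matrix.trace_smul, h1, Complex.star_def,
    Complex.conj_ofReal, smul_eq_mul, ← Complex.ofReal_mul, Complex.re_ofReal_mul]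

/-- The nontrivial Fourier sum is a quadratic form in `Q` given by fixed points. -/
lemma nontrivialFourierSum_eq [Fintype G] {X : Type*} [MulAction G X]
    [MulAction.IsPretransitive G X] [Fintype X] [Nonempty X] [DecidableEq X]
    {ι : Type*} [Fintype ι] {V : ι → Type*}
    [∀ j, NormedAddCommGroup (V j)] [∀ j, InnerProductSpace ℂ (V j)]
    {ρ : ∀ j, Representation ℂ G (V j)} (hρ : IsCompleteListOfIrreducibles ρ)
    (hinv : ∀ (j : ι) (g : G) (v w : V j), inner ℂ (ρ j g v) (ρ j g w) = inner ℂ v w)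
    {β : ι → Type*} [∀ j, Fintype (β j)] [∀ j, DecidableEq (β j)]
    (B : ∀ j, OrthonormalBasis (β j) ℂ (V j)) (Q : G → ℝ) (hQ_sum : ∑ g, Q g = 1) :
    nontrivialFourierSum X hρ B Q =
      ∑ g, ∑ h, Q g * Q h * (#{x : X | (g * h⁻¹) • x = x} : ℝ) - 1 := by
  classical
  have := hρ.finiteDimensional
  have hm := multiplicity_spec hρ (Representation.ofMulAction ℂ G X)
  rw [nontrivialFourierSum]
  generalize multiplicity hρ (Representation.ofMulAction ℂ G X) = m at hm
  -- Where the character is `1`, the quadratic form is `(∑ g, Q g)² = 1`, so only the multiplicities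
  -- remain.
  have htriv : ∑ j with Nonempty ((ρ j).Equiv (Representation.trivial ℂ G ℂ)),
      (m j : ℝ) * frobeniusSq (fourierMatrix (ρ j) (B j) fun g => (Q g : ℂ)) = 1 := by
    calc _ = ∑ j with Nonempty ((ρ j).Equiv (Representation.trivial ℂ G ℂ)), (m j : ℝ) := by
          refine Finset.sum_congr rfl fun j hj => ?_
          obtain ⟨φ⟩ := (Finset.mem_filter.1 hj).2
          rw [frobeniusSq_fourierMatrix (ρ j) (hinv j), Representation.char_iso φ]
          simp_rw [character_trivial, Complex.one_re, mul_one, ← Finset.mul_sum, hQ_sum, mul_one]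
          rw [hQ_sum, mul_one]
      _ = 1 := by exact_mod_cast sum_multiplicity_trivial hρ hm
  have hall : ∑ j, (m j : ℝ) * frobeniusSq (fourierMatrix (ρ j) (B j) fun g => (Q g : ℂ)) =
      ∑ g, ∑ h, Q g * Q h * (#{x : X | (g * h⁻¹) • x = x} : ℝ) := by
    simp_rw [fun j => frobeniusSq_fourierMatrix (ρ j) (hinv j) (B j) Q, Finset.mul_sum]
    rw [Finset.sum_comm]
    refine Finset.sum_congr rfl fun g _ => ?_
    rw [Finset.sum_comm]
    refine Finset.sum_congr rfl fun h _ => ?_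
    -- The sum over all `j` reassembles the permutation character, that is, the number of fixed
    -- points.
    have hc := congrArg Complex.re (hm.character_eq (g * h⁻¹))
    rw [character_ofMulAction, Complex.natCast_re, Complex.re_sum] at hc
    rw [hc, Finset.mul_sum]
    refine Finset.sum_congr rfl fun j _ => ?_
    rw [← Complex.ofReal_natCast, Complex.re_ofReal_mul]
    ring
  rw [← hall, ← Finset.sum_filter_add_sum_filter_not univ
    (fun j => Nonempty ((ρ j).Equiv (Representation.trivial ℂ G ℂ))), htriv]
  ring

end Fourier

/-! ### Norms on `ℂ X` and the squared distance of the walk from uniform. -/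

section Walk

variable {G : Type*} [Group G] [Fintype G] {X : Type*} [MulAction G X]

lemma coeff_step [DecidableEq X] (Q : G → ℝ) (x y : X) :
    (step Q x).coeff y = ((∑ g, if g • x = y then Q g else 0 : ℝ) : ℂ) := by
  rw [step, act, groupAlgebraElement, map_sum, LinearMap.sum_apply, MonoidAlgebra.coeff_sum,
    Finsupp.finsetSum_apply, Complex.ofReal_sum]
  refine Finset.sum_congr rfl fun g _ => ?_
  rw [Representation.asAlgebraHom_single, LinearMap.smul_apply,
    Representation.ofMulAction_single, MonoidAlgebra.coeff_smul, Finsupp.smul_apply,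
    MonoidAlgebra.coeff_single, Finsupp.single_apply]
  split_ifs <;> simp

variable [Fintype X]

lemma coeff_uniform (y : X) : (uniform X).coeff y = ((1 / (Fintype.card X : ℝ) : ℝ) : ℂ) := by
  classical
  rw [uniform, MonoidAlgebra.coeff_sum, Finsupp.finsetSum_apply]
  simp [MonoidAlgebra.coeff_single, Finsupp.single_apply]

lemma l2Norm_sq (h : ℂ[X]) : l2Norm h ^ 2 = ∑ y, ‖h.coeff y‖ ^ 2 :=
  Real.sq_sqrt (Finset.sum_nonneg fun _ _ => sq_nonneg _)

/-- The `ℓ²` norm is at most the `ℓ¹` norm, which is twice the total variation norm; hence the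
factor `4`. -/
lemma l2Norm_sq_le_four_mul_tvNorm_sq (h : ℂ[X]) : l2Norm h ^ 2 ≤ 4 * tvNorm h ^ 2 := by
  have := Finset.sum_sq_le_sq_sum_of_nonneg (s := univ) (f := fun y => ‖h.coeff y‖)
    fun _ _ => norm_nonneg _
  rw [l2Norm_sq, tvNorm]
  linarith

/-- Cauchy–Schwarz against the constant function `1` on `X`. -/
lemma four_mul_tvNorm_sq_le (h : ℂ[X]) :
    4 * tvNorm h ^ 2 ≤ Fintype.card X * l2Norm h ^ 2 := by
  have := sq_sum_le_card_mul_sum_sq (s := univ) (f := fun y => ‖h.coeff y‖)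
  rw [Finset.card_univ] at this
  rw [l2Norm_sq, tvNorm]
  linarith

/-- `q · e_x - u` is orthogonal to `u`. -/
lemma l2Norm_step_sub_uniform_sq [Nonempty X] (Q : G → ℝ) (hQ_sum : ∑ g, Q g = 1) (x : X) :
    l2Norm (step Q x - uniform X) ^ 2 = l2Norm (step Q x) ^ 2 - 1 / Fintype.card X := by
  classical
  have hX : (Fintype.card X : ℝ) ≠ 0 := by exact_mod_cast Fintype.card_ne_zero
  -- As `q · e_x` has total mass `1`, the cross term is `-2/|X|`, while `‖u‖₂²` adds `1/|X|`.
  have hsum : ∑ y, ∑ g, (if g • x = y then Q g else 0) = 1 := by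
    rw [Finset.sum_comm, ← hQ_sum]
    exact Finset.sum_congr rfl fun g _ => by simp
  simp_rw [l2Norm_sq, MonoidAlgebra.coeff_sub, Finsupp.sub_apply, coeff_step, coeff_uniform,
    ← Complex.ofReal_sub, Complex.norm_real, Real.norm_eq_abs, sq_abs, sub_sq,
    Finset.sum_add_distrib, Finset.sum_sub_distrib, ← Finset.sum_mul, ← Finset.mul_sum, hsum,
    Finset.sum_const, Finset.card_univ, nsmul_eq_mul]
  field_simp
  ring

/-- `‖q·e_x‖₂²` is the probability that two independent steps from `x` collide; summing over `x`
turns collisions into fixed points. -/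
lemma sum_l2Norm_step_sq [DecidableEq X] (Q : G → ℝ) :
    ∑ x : X, l2Norm (step Q x) ^ 2 =
      ∑ g, ∑ h, Q g * Q h * (#{x : X | (g * h⁻¹) • x = x} : ℝ) := by
  have h1 : ∀ x : X, l2Norm (step Q x) ^ 2 =
      ∑ g, ∑ h, Q g * Q h * if g • x = h • x then 1 else 0 := by
    intro x
    simp_rw [l2Norm_sq, coeff_step, Complex.norm_real, Real.norm_eq_abs, sq_abs, sq,
      Finset.sum_mul_sum]
    rw [Finset.sum_comm]
    refine Finset.sum_congr rfl fun g _ => ?_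
    rw [Finset.sum_comm]
    refine Finset.sum_congr rfl fun h _ => ?_
    -- For given `g` and `h`, only the endpoint `y = g • x` can contribute.
    rw [Finset.sum_eq_single (g • x) (fun y _ hy => by rw [if_neg hy.symm, zero_mul]) (by simp)]
    simp [eq_comm]
  simp_rw [h1]
  rw [Finset.sum_comm]
  refine Finset.sum_congr rfl fun g _ => ?_
  rw [Finset.sum_comm]
  refine Finset.sum_congr rfl fun h _ => ?_
  rw [← Finset.mul_sum, Finset.sum_boole]
  congr 2
  -- The map `x ↦ h • x` carries `{x | g • x = h • x}` onto the fixed points of `g * h⁻¹`.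
  refine Finset.card_equiv (MulAction.toPerm h) fun x => ?_
  simp [mul_smul]

/-- The nontrivial Fourier sum is the total squared distance of the walk from uniform. -/
lemma sum_l2Norm_step_sub_uniform_sq [MulAction.IsPretransitive G X] [Nonempty X]
    {ι : Type*} [Fintype ι] {V : ι → Type*}
    [∀ j, NormedAddCommGroup (V j)] [∀ j, InnerProductSpace ℂ (V j)]
    {ρ : ∀ j, Representation ℂ G (V j)} (hρ : IsCompleteListOfIrreducibles ρ)
    (hinv : ∀ (j : ι) (g : G) (v w : V j), inner ℂ (ρ j g v) (ρ j g w) = inner ℂ v w)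
    {β : ι → Type*} [∀ j, Fintype (β j)] [∀ j, DecidableEq (β j)]
    (B : ∀ j, OrthonormalBasis (β j) ℂ (V j)) (Q : G → ℝ) (hQ_sum : ∑ g, Q g = 1) :
    ∑ x : X, l2Norm (step Q x - uniform X) ^ 2 = nontrivialFourierSum X hρ B Q := by
  classical
  have hX : (Fintype.card X : ℝ) ≠ 0 := by exact_mod_cast Fintype.card_ne_zero
  simp_rw [l2Norm_step_sub_uniform_sq Q hQ_sum]
  rw [nontrivialFourierSum_eq hρ hinv B Q hQ_sum, Finset.sum_sub_distrib, sum_l2Norm_step_sq,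
    Finset.sum_const, Finset.card_univ, nsmul_eq_mul, mul_one_div_cancel hX]

end Walk

end HomogeneousWalk

/-! ### The averaged and the pointwise total variation bounds. -/

theorem theorem1 {G : Type*} [Group G] [Fintype G]
    {X : Type*} [MulAction G X] [MulAction.IsPretransitive G X] [Fintype X] [Nonempty X]
    -- the irreducible representations of `G`, with invariant inner products and orthonormal bases
    {ι : Type*} [Fintype ι] {V : ι → Type*}
    [∀ j, NormedAddCommGroup (V j)] [∀ j, InnerProductSpace ℂ (V j)]
    (ρ : ∀ j, Representation ℂ G (V j))
    (hρ : HomogeneousWalk.IsCompleteListOfIrreducibles ρ)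
    (hinv : ∀ (j : ι) (g : G) (v w : V j), inner ℂ (ρ j g v) (ρ j g w) = inner ℂ v w)
    {β : ι → Type*} [∀ j, Fintype (β j)] [∀ j, DecidableEq (β j)]
    (B : ∀ j, OrthonormalBasis (β j) ℂ (V j))
    -- the probability distribution on `G`
    (Q : G → ℝ) (hQ_nonneg : ∀ g, 0 ≤ Q g) (hQ_sum : ∑ g, Q g = 1) :
    ((1 / (Fintype.card X : ℝ)) * ∑ x : X, HomogeneousWalk.tvNorm
          (HomogeneousWalk.step Q x - HomogeneousWalk.uniform X) ^ 2 ≤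
        (1 / 4) * HomogeneousWalk.nontrivialFourierSum X hρ B Q ∧
      (1 / (4 * (Fintype.card X : ℝ))) * HomogeneousWalk.nontrivialFourierSum X hρ B Q ≤
        (1 / (Fintype.card X : ℝ)) * ∑ x : X, HomogeneousWalk.tvNorm
          (HomogeneousWalk.step Q x - HomogeneousWalk.uniform X) ^ 2) ∧
    ((∀ x y : X, HomogeneousWalk.l2Norm (HomogeneousWalk.step Q x) =
        HomogeneousWalk.l2Norm (HomogeneousWalk.step Q y)) →
      ∀ x : X,
        HomogeneousWalk.tvNorm (HomogeneousWalk.step Q x - HomogeneousWalk.uniform X) ^ 2 ≤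
          (1 / 4) * HomogeneousWalk.nontrivialFourierSum X hρ B Q ∧
        (1 / (4 * (Fintype.card X : ℝ))) * HomogeneousWalk.nontrivialFourierSum X hρ B Q ≤
          HomogeneousWalk.tvNorm (HomogeneousWalk.step Q x - HomogeneousWalk.uniform X) ^ 2) := by

  have hX : (0 : ℝ) < Fintype.card X := by exact_mod_cast Fintype.card_pos
  have hS := HomogeneousWalk.sum_l2Norm_step_sub_uniform_sq (X := X) hρ hinv B Q hQ_sum
  refine ⟨⟨?_, ?_⟩, fun hconst x => ?_⟩
  · have h := Finset.sum_le_sum fun x (_ : x ∈ Finset.univ) =>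
      HomogeneousWalk.four_mul_tvNorm_sq_le
        (HomogeneousWalk.step Q x - HomogeneousWalk.uniform X)
    rw [← Finset.mul_sum, ← Finset.mul_sum, hS] at h
    rw [one_div_mul_eq_div, div_le_iff₀ hX]
    linarith
  · have h := Finset.sum_le_sum fun x (_ : x ∈ Finset.univ) =>
      HomogeneousWalk.l2Norm_sq_le_four_mul_tvNorm_sq
        (HomogeneousWalk.step Q x - HomogeneousWalk.uniform X)
    rw [← Finset.mul_sum, hS] at h
    rw [one_div_mul_eq_div, one_div_mul_eq_div, div_le_div_iff₀ (by positivity) hX]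
    nlinarith
  -- The squared distance to uniform differs from `‖q·e_x‖₂²` by a constant, so it too is
  -- independent of `x`, and the sum in `hS` has `|X|` equal terms.
  · have hx : (Fintype.card X : ℝ) * HomogeneousWalk.l2Norm
        (HomogeneousWalk.step Q x - HomogeneousWalk.uniform X) ^ 2 =
        HomogeneousWalk.nontrivialFourierSum X hρ B Q := by
      rw [← hS, ← nsmul_eq_mul, ← Finset.card_univ, ← Finset.sum_const]
      refine Finset.sum_congr rfl fun y _ => ?_
      rw [HomogeneousWalk.l2Norm_step_sub_uniform_sq Q hQ_sum,
        HomogeneousWalk.l2Norm_step_sub_uniform_sq Q hQ_sum, hconst x y]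
    have h1 := HomogeneousWalk.four_mul_tvNorm_sq_le
      (HomogeneousWalk.step Q x - HomogeneousWalk.uniform X)
    have h2 := HomogeneousWalk.l2Norm_sq_le_four_mul_tvNorm_sq
      (HomogeneousWalk.step Q x - HomogeneousWalk.uniform X)
    rw [hx] at h1
    refine ⟨by linarith, ?_⟩
    rw [one_div_mul_eq_div, div_le_iff₀ (by positivity), ← hx]
    nlinarith
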